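/- Let $K$ be a field. For $k\in\mathbb N$ let $K[x]_{\le k}$ be the space of polynomials of degree at most $k$, and let $a_i=x^i$ ($0\le i\le n$), $b_j=x^j$ ($0\le j\le m$), $c_k=x^k$ ($0\le k\le n+m$) be the monomial bases of $K[x]_{\le n}$, $K[x]_{\le m}$, $K[x]_{\le n+m}$. The polynomial multiplication tensor for degrees $n$ and $m$ over $K$ is $$T_{n,m}^K=\sum_{i=0}^n\sum_{j=0}^m a_i\otimes b_j\otimes c_{i+j}\in K[x]_{\le n}\otimes K[x]_{\le m}\otimes K[x]_{\le n+m},$$ and this sum is its standard representation. A representation of a tensor $T\in U\otimes V\otimes W$ is a finite multiset of pure tensors $u\otimes v\otimes w$ with $u,v,w\neq0$ whose sum is $T$, and the rank of $T$ is the smallest number of terms of a representation of $T$. A flip replaces two terms that agree in one position, say $u\otimes v\otimes w$ and $u\otimes v'\otimes w'$, by $u\otimes(v-\lambda v')\otimes w$ and $u\otimes v'\otimes(w'+\lambda w)$ for some $\lambda\in K$; a reduction replaces two terms that agree in two positions, say $u\otimes v\otimes w$ and $u'\otimes v\otimes w$, by $(u+u')\otimes v\otimes w$; likewise for the other positions.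 The flip graph of $T$ is the directed graph whose vertices are the representations of $T$, with an edge from $S$ to $S'$ whenever $S'$ is obtained from $S$ by a flip or a reduction. Theorem. (a) Let $K=\mathbb Z_2$ be the field with two elements. For each $$(n,m)\in\{(1,1),(1,2),(1,3),(1,4),(1,5),(2,2),(2,3),(2,4),(3,3)\},$$ the flip graph of $T_{n,m}^{\mathbb Z_2}$ has a directed path from the standard representation to a representation whose number of terms is the rank of $T_{n,m}^{\mathbb Z_2}$; and these ranks are, in this order, $3,5,6,8,9,6,8,10,9$. (b) In contrast, for every field $K$ with at least $5$ elements, the rank of $T_{2,2}^K$ is $5$. -/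

import Mathlib

open scoped TensorProduct

section Representations

variable {K U V W : Type*} [Field K] [AddCommGroup U] [AddCommGroup V] [AddCommGroup W]
  [Module K U] [Module K V] [Module K W]

/-- Pure tensors, i.e. tensors of rank one: `u ⊗ v ⊗ w` with nonzero factors. -/
def IsPureTensor (t : U ⊗[K] V ⊗[K] W) : Prop :=
  ∃ (u : U) (v : V) (w : W), u ≠ 0 ∧ v ≠ 0 ∧ w ≠ 0 ∧ t = u ⊗ₜ[K] v ⊗ₜ[K] w

/-- A representation of the tensor `T`: a finite unordered collection of pure tensors
(repetitions allowed) whose sum is `T`. -/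
structure TensorRep (T : U ⊗[K] V ⊗[K] W) where
  terms : Multiset (U ⊗[K] V ⊗[K] W)
  pure : ∀ t ∈ terms, IsPureTensor t
  sum_eq : terms.sum = T

/-- The number of terms of a representation. -/
def TensorRep.length {T : U ⊗[K] V ⊗[K] W} (S : TensorRep T) : ℕ :=
  Multiset.card S.terms

/-- The rank of a tensor: the least number of terms of a representation. -/
noncomputable def tensorRank (T : U ⊗[K] V ⊗[K] W) : ℕ :=
  sInf (Set.range fun S : TensorRep T => S.length)

/-- `FlipPair s t s' t'`: the terms `s, t` agree in one position, and the flip with some parameter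
`l` replaces them by `s', t'`. One constructor for each position in which the terms agree.
(Interchanging the roles of the two other positions amounts to interchanging the two terms and
replacing `l` by `-l`.) -/
inductive FlipPair : U ⊗[K] V ⊗[K] W → U ⊗[K] V ⊗[K] W →
    U ⊗[K] V ⊗[K] W → U ⊗[K] V ⊗[K] W → Prop
  | first (l : K) (u : U) (v v' : V) (w w' : W) :
      FlipPair (u ⊗ₜ[K] v ⊗ₜ[K] w) (u ⊗ₜ[K] v' ⊗ₜ[K] w')
        (u ⊗ₜ[K] (v - l • v') ⊗ₜ[K] w) (u ⊗ₜ[K] v' ⊗ₜ[K] (w' + l • w))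
  | second (l : K) (u u' : U) (v : V) (w w' : W) :
      FlipPair (u ⊗ₜ[K] v ⊗ₜ[K] w) (u' ⊗ₜ[K] v ⊗ₜ[K] w')
        ((u - l • u') ⊗ₜ[K] v ⊗ₜ[K] w) (u' ⊗ₜ[K] v ⊗ₜ[K] (w' + l • w))
  | third (l : K) (u u' : U) (v v' : V) (w : W) :
      FlipPair (u ⊗ₜ[K] v ⊗ₜ[K] w) (u' ⊗ₜ[K] v' ⊗ₜ[K] w)
        ((u - l • u') ⊗ₜ[K] v ⊗ₜ[K] w) (u' ⊗ₜ[K] (v' + l • v) ⊗ₜ[K] w)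

/-- `ReductionPair s t r`: the terms `s, t` agree in two positions and merge into `r`. -/
inductive ReductionPair : U ⊗[K] V ⊗[K] W → U ⊗[K] V ⊗[K] W → U ⊗[K] V ⊗[K] W → Prop
  | first (u u' : U) (v : V) (w : W) :
      ReductionPair (u ⊗ₜ[K] v ⊗ₜ[K] w) (u' ⊗ₜ[K] v ⊗ₜ[K] w) ((u + u') ⊗ₜ[K] v ⊗ₜ[K] w)
  | second (u : U) (v v' : V) (w : W) :
      ReductionPair (u ⊗ₜ[K] v ⊗ₜ[K] w) (u ⊗ₜ[K] v' ⊗ₜ[K] w) (u ⊗ₜ[K] (v + v') ⊗ₜ[K] w)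
  | third (u : U) (v : V) (w w' : W) :
      ReductionPair (u ⊗ₜ[K] v ⊗ₜ[K] w) (u ⊗ₜ[K] v ⊗ₜ[K] w') (u ⊗ₜ[K] v ⊗ₜ[K] (w + w'))

/-- `S'` arises from `S` by a flip of two of its terms. -/
def TensorRep.IsFlip {T : U ⊗[K] V ⊗[K] W} (S S' : TensorRep T) : Prop :=
  ∃ (R : Multiset (U ⊗[K] V ⊗[K] W)) (s t s' t' : U ⊗[K] V ⊗[K] W),
    FlipPair s t s' t' ∧ S.terms = s ::ₘ t ::ₘ R ∧ S'.terms = s' ::ₘ t' ::ₘ R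

/-- `S'` arises from `S` by a reduction of two of its terms. -/
def TensorRep.IsReduction {T : U ⊗[K] V ⊗[K] W} (S S' : TensorRep T) : Prop :=
  ∃ (R : Multiset (U ⊗[K] V ⊗[K] W)) (s t r : U ⊗[K] V ⊗[K] W),
    ReductionPair s t r ∧ S.terms = s ::ₘ t ::ₘ R ∧ S'.terms = r ::ₘ R

/-- The flip graph of a tensor. Edges are directed, so that a reduction cannot be traversed
backwards (this would be a split). -/
def flipGraph (T : U ⊗[K] V ⊗[K] W) : Digraph (TensorRep T) where
  Adj S S' := S.IsFlip S' ∨ S.IsReduction S'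

/-- There is a (possibly trivial) directed path in the flip graph from `S` to `S'`. -/
def HasFlipPath {T : U ⊗[K] V ⊗[K] W} (S S' : TensorRep T) : Prop :=
  Relation.ReflTransGen (flipGraph T).Adj S S'

end Representations

section PolynomialMultiplication

variable (K : Type*) [Field K]

/-- The basis element `x ^ i` of the space of polynomials of degree at most `n`, for `i ≤ n`. -/
noncomputable def monomialLE (n : ℕ) (i : Fin (n + 1)) : Polynomial.degreeLE K (n : WithBot ℕ) :=
  ⟨Polynomial.X ^ (i : ℕ), Polynomial.mem_degreeLE.2 <|
    (Polynomial.degree_X_pow_le _).trans (by exact_mod_cast Nat.lt_succ_iff.1 i.2)⟩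

theorem monomialLE_ne_zero (n : ℕ) (i : Fin (n + 1)) : monomialLE K n i ≠ 0 := fun h =>
  pow_ne_zero (i : ℕ) (Polynomial.X_ne_zero (R := K)) (congrArg Subtype.val h)

/-- The term `a_i ⊗ b_j ⊗ c_{i+j}`. -/
noncomputable def stdTerm (n m : ℕ) (p : Fin (n + 1) × Fin (m + 1)) :
    Polynomial.degreeLE K (n : WithBot ℕ) ⊗[K] Polynomial.degreeLE K (m : WithBot ℕ) ⊗[K]
      Polynomial.degreeLE K ((n + m : ℕ) : WithBot ℕ) :=
  monomialLE K n p.1 ⊗ₜ[K] monomialLE K m p.2 ⊗ₜ[K]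
    monomialLE K (n + m) ⟨p.1 + p.2, by have := p.1.2; have := p.2.2; omega⟩

/-- The polynomial multiplication tensor for degrees `n` and `m` over `K`. -/
noncomputable def polyMulTensor (n m : ℕ) :
    Polynomial.degreeLE K (n : WithBot ℕ) ⊗[K] Polynomial.degreeLE K (m : WithBot ℕ) ⊗[K]
      Polynomial.degreeLE K ((n + m : ℕ) : WithBot ℕ) :=
  ∑ p : Fin (n + 1) × Fin (m + 1), stdTerm K n m p

/-- The standard representation of the polynomial multiplication tensor. -/
noncomputable def standardRep (n m : ℕ) : TensorRep (polyMulTensor K n m) where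
  terms := (Finset.univ : Finset (Fin (n + 1) × Fin (m + 1))).val.map (stdTerm K n m)
  pure := by
    intro t ht
    obtain ⟨p, -, rfl⟩ := Multiset.mem_map.1 ht
    exact ⟨_, _, _, monomialLE_ne_zero K _ _, monomialLE_ne_zero K _ _,
      monomialLE_ne_zero K _ _, rfl⟩
  sum_eq := rfl

end PolynomialMultiplication

/-!
A representation of `T_{n,m}` with `r` terms is a bilinear algorithm which multiplies polynomials
of degree at most `n` and `m` by means of `r` products. The linear forms `α p` of such an algorithm
embed the polynomials of degree at most `n` into `K ^ r` as a linear code of minimum distance at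
least `m + 1`, because a nonzero `g` of degree at most `m` can be chosen to kill any `m` of the
products, and `f * g ≠ 0`. The Griesmer bound for this code is the rank, except for `(2, 3)` and
`(3, 3)`. There let `α` belong to a factor of degree at most `n = 3`, and suppose that two of the
forms `α p` vanish on an irreducible cubic `P`. They also vanish on some polynomial `f ≠ 0` of
degree at most `2`, which is coprime to `P`, so the multiples of `P` and `f`, and hence the other
products, span all polynomials of degree at most `n + m`. This would take `n + m + 3` products in
total. With fewer, each of the two irreducible cubics over the field with two elements is a zero of
at most one `α p`, and their difference contradicts the minimum distance of the code.

For the upper bounds, consider the terms `x ^ i ⊗ v ⊗ w` with fixed `i`. A flip of two of them acts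
on the pairs `(v, w)` as an elementary matrix, so linearly independent `v`s and `w`s can be replaced
by any others of the same number with the same `∑ v ⊗ w`. If in some decomposition each `x ^ i`
occurs in exactly `m + 1` of the first factors `∑ x ^ i`, then flips reach the decomposition with
these factors expanded, and reductions merge its terms.

Over a field with more than `n + m` elements, evaluation and interpolation give rank `n + m + 1`.
-/

section GriesmerBound

open Finset

theorem ceilDiv_ceilDiv (d : ℕ) {a b : ℕ} (ha : 0 < a) (hb : 0 < b) :
    d ⌈/⌉ a ⌈/⌉ b = d ⌈/⌉ (a * b) :=
  eq_of_forall_ge_iff fun c => by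
    rw [ceilDiv_le_iff_le_mul hb, ceilDiv_le_iff_le_mul ha, ceilDiv_le_iff_le_mul (mul_pos ha hb),
      mul_assoc]

variable {K ι : Type*} [Field K]

/-- The part of a word outside the support of `x`. The image of a code which contains `x` is its
residual code. -/
def residualWord (x : ι → K) : (ι → K) →ₗ[K] ({p // x p = 0} → K) :=
  LinearMap.funLeft K K Subtype.val

theorem residualWord_self (x : ι → K) : residualWord x x = 0 :=
  funext fun p => p.2

variable [DecidableEq K] [Fintype ι]

theorem hammingNorm_add_card_zeros (x : ι → K) :
    hammingNorm x + Fintype.card {p // x p = 0} = Fintype.card ι := by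
  rw [Fintype.card_subtype, hammingNorm, add_comm]
  exact card_filter_add_card_filter_not _

theorem card_smul_add_ne_zero [Fintype K] (a b : K) :
    #{c : K | c • a + b ≠ 0} =
      if a = 0 then (if b = 0 then 0 else Fintype.card K) else Fintype.card K - 1 := by
  split_ifs with ha hb
  · simp [ha, hb]
  · simp [ha, hb, Finset.card_univ]
  · have h : ({c : K | c • a + b ≠ 0} : Finset K) = {-b / a}ᶜ := by
      ext c
      simp [eq_div_iff ha, eq_neg_iff_add_eq_zero]
    rw [h, card_compl, card_singleton]

theorem sum_hammingNorm_smul_add [Fintype K] (x y : ι → K) :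
    ∑ c : K, hammingNorm (c • x + y) =
      (Fintype.card K - 1) * hammingNorm x + Fintype.card K * hammingNorm (residualWord x y) := by
  have hres : hammingNorm (residualWord x y) = #{p | x p = 0 ∧ y p ≠ 0} := by
    rw [← Fintype.card_subtype, hammingNorm, ← Fintype.card_subtype]
    exact Fintype.card_congr (Equiv.subtypeSubtypeEquivSubtypeInter (x · = 0) (y · ≠ 0))
  calc ∑ c : K, hammingNorm (c • x + y) = ∑ p, #{c : K | c • x p + y p ≠ 0} := by
        simp only [hammingNorm, card_filter]
        exact sum_comm
    _ = ∑ p, ((if x p ≠ 0 then Fintype.card K - 1 else 0) +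
          if x p = 0 ∧ y p ≠ 0 then Fintype.card K else 0) := by
        refine sum_congr rfl fun p _ => ?_
        rw [card_smul_add_ne_zero]
        by_cases hx : x p = 0 <;> by_cases hy : y p = 0 <;> simp [hx, hy]
    _ = _ := by
        rw [sum_add_distrib, hres, hammingNorm, ← sum_filter, ← sum_filter, sum_const, sum_const,
          smul_eq_mul, smul_eq_mul, mul_comm, mul_comm (Fintype.card K)]

theorem hammingNorm_le_card_mul_hammingNorm_residualWord [Fintype K] {x y : ι → K}
    (h : ∀ c : K, hammingNorm x ≤ hammingNorm (c • x + y)) :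
    hammingNorm x ≤ Fintype.card K * hammingNorm (residualWord x y) := by
  have hsum : Fintype.card K * hammingNorm x ≤ ∑ c : K, hammingNorm (c • x + y) := by
    simpa using card_nsmul_le_sum univ _ _ fun c _ => h c
  rw [sum_hammingNorm_smul_add] at hsum
  obtain ⟨k, hk⟩ := Nat.exists_eq_add_of_le' (Fintype.card_pos (α := K))
  simp only [hk, Nat.add_sub_cancel] at hsum ⊢
  linarith

theorem hammingNorm_le_card_mul_of_notMem_span [Fintype K] {C : Submodule K (ι → K)} {x y : ι → K}
    (hxC : x ∈ C) (hmin : ∀ z ∈ C, z ≠ 0 → hammingNorm x ≤ hammingNorm z) (hyC : y ∈ C)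
    (hy : y ∉ K ∙ x) : hammingNorm x ≤ Fintype.card K * hammingNorm (residualWord x y) :=
  hammingNorm_le_card_mul_hammingNorm_residualWord fun c =>
    hmin _ (C.add_mem (C.smul_mem c hxC) hyC) fun h =>
      hy (Submodule.mem_span_singleton.2 ⟨-c, by rw [neg_smul, eq_neg_of_add_eq_zero_right h]⟩)

theorem finrank_le_finrank_map_residualWord [Finite K] {C : Submodule K (ι → K)} {x : ι → K}
    (hxC : x ∈ C) (hx : x ≠ 0) (hmin : ∀ z ∈ C, z ≠ 0 → hammingNorm x ≤ hammingNorm z) :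
    Module.finrank K C ≤ Module.finrank K (C.map (residualWord x)) + 1 := by
  have := Fintype.ofFinite K
  have hker : LinearMap.ker ((residualWord x).domRestrict C) ≤ K ∙ (⟨x, hxC⟩ : C) := by
    rintro ⟨y, hyC⟩ hy
    by_contra hspan
    have hle := hammingNorm_le_card_mul_of_notMem_span hxC hmin hyC fun hmem => hspan <| by
      obtain ⟨c, hc⟩ := Submodule.mem_span_singleton.1 hmem
      exact Submodule.mem_span_singleton.2 ⟨c, Subtype.ext hc⟩
    rw [show residualWord x y = 0 from hy, hammingNorm_zero, mul_zero] at hle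
    exact hx (hammingNorm_eq_zero.1 (Nat.le_zero.1 hle))
  rw [← LinearMap.finrank_range_add_finrank_ker ((residualWord x).domRestrict C),
    LinearMap.range_domRestrict]
  gcongr
  exact (Submodule.finrank_mono hker).trans_eq
    (finrank_span_singleton fun h => hx (congrArg Subtype.val h))

theorem griesmer_bound [Fintype K] (C : Submodule K (ι → K)) {d k : ℕ} (hd : 0 < d)
    (hk : k ≤ Module.finrank K C) (hC : ∀ x ∈ C, x ≠ 0 → d ≤ hammingNorm x) :
    ∑ i ∈ range k, d ⌈/⌉ Fintype.card K ^ i ≤ Fintype.card ι := by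
  induction k generalizing ι d with
  | zero => simp
  | succ k ih =>
    have hq : 0 < Fintype.card K := Fintype.card_pos
    obtain ⟨x, ⟨hxC, hx⟩, hmin⟩ := exists_minimalFor_of_wellFoundedLT
      (fun x => x ∈ C ∧ x ≠ 0) hammingNorm
      (C.ne_bot_iff.1 (Submodule.one_le_finrank_iff.1 (by omega)))
    replace hmin : ∀ z ∈ C, z ≠ 0 → hammingNorm x ≤ hammingNorm z := fun z hzC hz =>
      (le_total _ _).elim id (hmin ⟨hzC, hz⟩)
    have hd' : 0 < d ⌈/⌉ Fintype.card K := not_le.1 fun h =>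
      hd.not_ge (by simpa using (ceilDiv_le_iff_le_mul hq).1 h)
    have hres : ∀ z ∈ C.map (residualWord x), z ≠ 0 → d ⌈/⌉ Fintype.card K ≤ hammingNorm z := by
      rintro _ ⟨y, hyC, rfl⟩ hy
      refine (ceilDiv_le_iff_le_mul hq).2 ((hC x hxC hx).trans ?_)
      refine hammingNorm_le_card_mul_of_notMem_span hxC hmin hyC fun hmem => hy ?_
      obtain ⟨c, rfl⟩ := Submodule.mem_span_singleton.1 hmem
      rw [map_smul, residualWord_self, smul_zero]
    calc ∑ i ∈ range (k + 1), d ⌈/⌉ Fintype.card K ^ i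
        = d + ∑ i ∈ range k, d ⌈/⌉ Fintype.card K ⌈/⌉ Fintype.card K ^ i := by
          simp only [sum_range_succ', ceilDiv_ceilDiv d hq, pow_pos hq, ← pow_succ', pow_zero,
            ceilDiv_one, add_comm]
      _ ≤ hammingNorm x + Fintype.card {p // x p = 0} := by
          refine add_le_add (hC x hxC hx) (ih _ hd' ?_ hres)
          have := finrank_le_finrank_map_residualWord hxC hx hmin
          omega
      _ = Fintype.card ι := hammingNorm_add_card_zeros x

end GriesmerBound

section MulAlgorithms

open Finset Polynomial

theorem exists_ne_zero_forall_dual_apply_eq_zero {K V ι : Type*} [Field K] [AddCommGroup V]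
    [Module K V] (φ : ι → Module.Dual K V) {s : Finset ι} (hs : #s < Module.finrank K V) :
    ∃ x, x ≠ 0 ∧ ∀ p ∈ s, φ p x = 0 := by
  have := Module.finite_of_finrank_pos (Nat.zero_lt_of_lt hs)
  have hker : LinearMap.ker (LinearMap.pi fun p : s => φ p) ≠ ⊥ :=
    LinearMap.ker_ne_bot_of_finrank_lt (by simpa using hs)
  obtain ⟨x, hx, hx0⟩ := Submodule.exists_mem_ne_zero_of_ne_bot hker
  exact ⟨x, hx0, fun p hp => congrFun hx ⟨p, hp⟩⟩

section Polynomials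

variable {K : Type*} [Field K] {n m : ℕ}

variable (K) in
/-- The basis `1, x, …, x ^ n` of the space of polynomials of degree at most `n`. -/
noncomputable def monomialBasis (n : ℕ) :
    Module.Basis (Fin (n + 1)) K (degreeLE K (n : WithBot ℕ)) :=
  (degreeLT.basis K (n + 1)).map (LinearEquiv.ofEq _ _ degreeLT_succ_eq_degreeLE)

@[simp]
theorem monomialBasis_apply (i : Fin (n + 1)) : monomialBasis K n i = monomialLE K n i :=
  Subtype.ext <| by
    rw [monomialBasis, Module.Basis.map_apply, LinearEquiv.coe_ofEq_apply, degreeLT.basis_val]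
    rfl

theorem finrank_degreeLE (n : ℕ) : Module.finrank K (degreeLE K (n : WithBot ℕ)) = n + 1 := by
  simpa using Module.finrank_eq_card_basis (monomialBasis K n)

theorem exists_mul_add_mul_eq_of_isCoprime {f g h : K[X]} (hfg : IsCoprime f g) (hf : f.degree ≤ n)
    (hg : g.degree = n) (hnm : n ≤ m + 1) (hh : h.degree ≤ (n + m : ℕ)) :
    ∃ a b : K[X], a.degree ≤ m ∧ b.degree ≤ m ∧ f * a + g * b = h := by
  obtain ⟨u, v, huv⟩ := hfg
  set a := h * u % g
  set b := h * v + f * (h * u / g)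
  have hsum : f * a + g * b = h := by
    linear_combination f * EuclideanDomain.div_add_mod (h * u) g + h * huv
  have hg0 : g ≠ 0 := fun h0 => by simp [h0] at hg
  have ha' : a.degree ≤ m := by
    have : a.degree < (m + 1 : ℕ) := (degree_mod_lt _ hg0).trans_le (by rw [hg]; exact_mod_cast hnm)
    exact Order.lt_succ_iff.1 this
  refine ⟨a, b, ha', ?_, hsum⟩
  have hgb : (g * b).degree ≤ (n + m : ℕ) := by
    rw [eq_sub_of_add_eq' hsum]
    refine (degree_sub_le _ _).trans (max_le hh ((degree_mul_le _ _).trans ?_))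
    push_cast
    gcongr
  rw [degree_mul, hg, Nat.cast_add] at hgb
  exact (WithBot.add_le_add_iff_left (WithBot.natCast_ne_bot n)).1 hgb

end Polynomials

/-- The bilinear algorithm which multiplies polynomials of degree at most `n` by polynomials of
degree at most `m` through the products `α p f * β p g` is correct. The number of multiplications
is the cardinality of `ι`. -/
def IsMulAlgorithm {K ι : Type*} [Field K] [Fintype ι] {n m : ℕ}
    (α : ι → Module.Dual K (degreeLE K (n : WithBot ℕ)))
    (β : ι → Module.Dual K (degreeLE K (m : WithBot ℕ))) (w : ι → K[X]) : Prop :=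
  ∀ f g, ∑ p, (α p f * β p g) • w p = (f * g : K[X])

namespace IsMulAlgorithm

variable {K ι : Type*} [Field K] [Fintype ι] {n m : ℕ}
  {α : ι → Module.Dual K (degreeLE K (n : WithBot ℕ))}
  {β : ι → Module.Dual K (degreeLE K (m : WithBot ℕ))} {w : ι → K[X]}

theorem swap (h : IsMulAlgorithm α β w) : IsMulAlgorithm β α w := fun f g => by
  rw [mul_comm, ← h g f]
  simp only [mul_comm]

theorem lt_hammingNorm [DecidableEq K] (h : IsMulAlgorithm α β w)
    {f : degreeLE K (n : WithBot ℕ)} (hf : f ≠ 0) : m < hammingNorm fun p => α p f := by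
  by_contra! hlt
  obtain ⟨g, hg, hβ⟩ := exists_ne_zero_forall_dual_apply_eq_zero β
    (s := {p | α p f ≠ 0}) (by rw [finrank_degreeLE]; exact Nat.lt_succ_of_le hlt)
  have hfg : (f * g : K[X]) = 0 := by
    rw [← h f g]
    refine sum_eq_zero fun p _ => ?_
    by_cases hp : α p f = 0
    · simp [hp]
    · simp [hβ p (by simpa using hp)]
  simp [hf, hg] at hfg

theorem sum_ceilDiv_le_card [Fintype K] (h : IsMulAlgorithm α β w) :
    ∑ i ∈ range (n + 1), (m + 1) ⌈/⌉ Fintype.card K ^ i ≤ Fintype.card ι := by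
  classical
  have hinj : Function.Injective (LinearMap.pi α) :=
    (injective_iff_map_eq_zero _).2 fun f hf => by
      by_contra hf0
      have := h.lt_hammingNorm hf0
      rw [show (fun p => α p f) = 0 from hf, hammingNorm_zero] at this
      omega
  refine griesmer_bound (LinearMap.range (LinearMap.pi α)) m.succ_pos ?_ ?_
  · rw [LinearMap.finrank_range_of_inj hinj, finrank_degreeLE]
  · rintro _ ⟨f, rfl⟩ hf
    exact h.lt_hammingNorm fun h0 => hf (by rw [h0, map_zero])

theorem mul_mem_span (h : IsMulAlgorithm α β w) {s : Finset ι}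
    {f : degreeLE K (n : WithBot ℕ)} (hf : ∀ p ∈ s, α p f = 0) (g : degreeLE K (m : WithBot ℕ)) :
    (f * g : K[X]) ∈ Submodule.span K (w '' {p | p ∉ s}) := by
  rw [← h f g]
  refine Submodule.sum_mem _ fun p _ => ?_
  by_cases hp : p ∈ s
  · simp [hf p hp]
  · exact Submodule.smul_mem _ _ (Submodule.subset_span (Set.mem_image_of_mem w hp))

theorem card_add_lt_card_of_isCoprime (h : IsMulAlgorithm α β w) (hnm : n ≤ m + 1)
    {f g : degreeLE K (n : WithBot ℕ)} (hfg : IsCoprime (f : K[X]) g) (hg : (g : K[X]).degree = n)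
    {s : Finset ι} (hαf : ∀ p ∈ s, α p f = 0) (hαg : ∀ p ∈ s, α p g = 0) :
    n + m + #s < Fintype.card ι := by
  classical
  have hspan : degreeLE K ((n + m : ℕ) : WithBot ℕ) ≤
      Submodule.span K (w '' {p | p ∉ s}) := fun e he => by
    obtain ⟨a, b, ha, hb, rfl⟩ := exists_mul_add_mul_eq_of_isCoprime hfg (mem_degreeLE.1 f.2) hg
      hnm (mem_degreeLE.1 he)
    exact add_mem (h.mul_mem_span hαf ⟨a, mem_degreeLE.2 ha⟩)
      (h.mul_mem_span hαg ⟨b, mem_degreeLE.2 hb⟩)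
  have hcard : n + m + 1 ≤ #sᶜ := by
    rw [show w '' {p | p ∉ s} = (sᶜ.image w : Finset K[X]) by ext; simp] at hspan
    rw [← finrank_degreeLE (K := K)]
    exact (Submodule.finrank_mono hspan).trans ((finrank_span_finset_le_card _).trans card_image_le)
  have := card_add_card_compl s
  omega

theorem add_lt_card (h : IsMulAlgorithm α β w) : n + m < Fintype.card ι := by
  wlog hnm : n ≤ m generalizing n m
  · simpa only [add_comm] using this h.swap (by omega)
  exact h.card_add_lt_card_of_isCoprime (s := ∅) (f := ⟨1, mem_degreeLE.2 (by simp)⟩)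
    (g := ⟨X ^ n, mem_degreeLE.2 (by simp)⟩) (by omega) isCoprime_one_left (by simp) (by simp)
    (by simp)

theorem card_add_lt_card_of_irreducible (h : IsMulAlgorithm α β w) (hnm : n ≤ m + 1)
    {P : degreeLE K (n : WithBot ℕ)} (hirr : Irreducible (P : K[X])) (hdeg : (P : K[X]).degree = n)
    {s : Finset ι} (hα : ∀ p ∈ s, α p P = 0) (hs : #s < n) : n + m + #s < Fintype.card ι := by
  have hle : degreeLT K n ≤ degreeLE K (n : WithBot ℕ) := fun f hf =>
    mem_degreeLE.2 (mem_degreeLT.1 hf).le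
  obtain ⟨⟨f, hfdeg⟩, hf, hαf⟩ := exists_ne_zero_forall_dual_apply_eq_zero
    (fun p => α p ∘ₗ Submodule.inclusion hle) (hs.trans_eq (by
      simpa using (Module.finrank_eq_card_basis (degreeLT.basis K n)).symm))
  have hf0 : f ≠ 0 := fun h0 => hf (Subtype.ext h0)
  have hdvd : ¬ (P : K[X]) ∣ f :=
    not_dvd_of_degree_lt hf0 ((mem_degreeLT.1 hfdeg).trans_eq hdeg.symm)
  exact h.card_add_lt_card_of_isCoprime hnm (f := ⟨f, hle hfdeg⟩)
    (hirr.coprime_iff_not_dvd.2 hdvd).symm hdeg hαf hα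

theorem add_lt_card_of_irreducible_of_ne {n m c : ℕ}
    {α : ι → Module.Dual (ZMod 2) (degreeLE (ZMod 2) (n : WithBot ℕ))}
    {β : ι → Module.Dual (ZMod 2) (degreeLE (ZMod 2) (m : WithBot ℕ))} {w : ι → (ZMod 2)[X]}
    (h : IsMulAlgorithm α β w) (hnm : n ≤ m + 1) (hcn : c < n) (hcm : 2 * c ≤ m + 2)
    {P Q : degreeLE (ZMod 2) (n : WithBot ℕ)} (hP : Irreducible (P : (ZMod 2)[X]))
    (hPdeg : (P : (ZMod 2)[X]).degree = n) (hQ : Irreducible (Q : (ZMod 2)[X]))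
    (hQdeg : (Q : (ZMod 2)[X]).degree = n) (hPQ : P ≠ Q) : n + m + c < Fintype.card ι := by
  by_contra! hle
  have hzeros : ∀ {R : degreeLE (ZMod 2) (n : WithBot ℕ)}, Irreducible (R : (ZMod 2)[X]) →
      (R : (ZMod 2)[X]).degree = n → #{p | α p R = 0} < c := fun {R} hR hdeg => by
    by_contra! hcard
    obtain ⟨s, hs, rfl⟩ := exists_subset_card_eq hcard
    exact hle.not_gt (h.card_add_lt_card_of_irreducible hnm hR hdeg
      (fun p hp => (mem_filter.1 (hs hp)).2) hcn)
  -- Over the field with two elements, `P - Q` vanishes wherever neither `P` nor `Q` does.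
  have hsub : hammingNorm (fun p => α p (P - Q)) ≤ #{p | α p P = 0} + #{p | α p Q = 0} := by
    classical
    refine (card_le_card fun p hp => ?_).trans (card_union_le _ _)
    simp only [map_sub, mem_filter, mem_union, mem_univ, true_and] at hp ⊢
    exact (by decide : ∀ x y : ZMod 2, x - y ≠ 0 → x = 0 ∨ y = 0) _ _ hp
  have := h.lt_hammingNorm (sub_ne_zero.2 hPQ)
  have := hzeros hP hPdeg
  have := hzeros hQ hQdeg
  omega

end IsMulAlgorithm

theorem irreducible_X_pow_three_add_X_add_one : Irreducible (X ^ 3 + X + 1 : (ZMod 2)[X]) := by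
  have hdeg : (X ^ 3 + X + 1 : (ZMod 2)[X]).natDegree = 3 := by compute_degree!
  refine irreducible_of_degree_le_three_of_not_isRoot (by simp [hdeg]) fun a => ?_
  simpa using (by decide : ∀ a : ZMod 2, a ^ 3 + a + 1 ≠ 0) a

theorem irreducible_X_pow_three_add_X_sq_add_one :
    Irreducible (X ^ 3 + X ^ 2 + 1 : (ZMod 2)[X]) := by
  have hdeg : (X ^ 3 + X ^ 2 + 1 : (ZMod 2)[X]).natDegree = 3 := by compute_degree!
  refine irreducible_of_degree_le_three_of_not_isRoot (by simp [hdeg]) fun a => ?_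
  simpa using (by decide : ∀ a : ZMod 2, a ^ 3 + a ^ 2 + 1 ≠ 0) a

theorem IsMulAlgorithm.add_six_le_card_of_cubic {ι : Type*} [Fintype ι] {m : ℕ} (hm : 2 ≤ m)
    {α : ι → Module.Dual (ZMod 2) (degreeLE (ZMod 2) ((3 : ℕ) : WithBot ℕ))}
    {β : ι → Module.Dual (ZMod 2) (degreeLE (ZMod 2) (m : WithBot ℕ))} {w : ι → (ZMod 2)[X]}
    (h : IsMulAlgorithm α β w) : m + 6 ≤ Fintype.card ι := by
  have hP : (X ^ 3 + X + 1 : (ZMod 2)[X]).degree = (3 : ℕ) := by compute_degree!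
  have hQ : (X ^ 3 + X ^ 2 + 1 : (ZMod 2)[X]).degree = (3 : ℕ) := by compute_degree!
  have hPQ : (X ^ 3 + X + 1 : (ZMod 2)[X]) ≠ X ^ 3 + X ^ 2 + 1 := fun heq => by
    simpa [coeff_X, coeff_one] using congrArg (coeff · 1) heq
  have := h.add_lt_card_of_irreducible_of_ne (by omega) (by omega : 2 < 3) (by omega)
    (P := ⟨_, mem_degreeLE.2 hP.le⟩) (Q := ⟨_, mem_degreeLE.2 hQ.le⟩)
    irreducible_X_pow_three_add_X_add_one hP irreducible_X_pow_three_add_X_sq_add_one hQ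
    fun heq => hPQ (congrArg Subtype.val heq)
  omega

end MulAlgorithms

section Rank

open Polynomial

section TensorRep

variable {K U V W : Type*} [Field K] [AddCommGroup U] [AddCommGroup V] [AddCommGroup W]
  [Module K U] [Module K V] [Module K W]

theorem tensorRank_eq {T : U ⊗[K] V ⊗[K] W} {r : ℕ} (S : TensorRep T) (hS : S.length = r)
    (h : ∀ S : TensorRep T, r ≤ S.length) : tensorRank T = r :=
  le_antisymm (Nat.sInf_le ⟨S, hS⟩) (le_csInf ⟨_, S, rfl⟩ (by rintro _ ⟨S, rfl⟩; exact h S))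

theorem TensorRep.exists_factors {T : U ⊗[K] V ⊗[K] W} (S : TensorRep T) :
    ∃ (u : Fin S.length → U) (v : Fin S.length → V) (w : Fin S.length → W),
      ∑ p, u p ⊗ₜ[K] v p ⊗ₜ[K] w p = T := by
  obtain ⟨terms, hpure, hsum⟩ := S
  induction terms using Quotient.inductionOn with | _ l
  have h : ∀ p : Fin l.length, ∃ (u : U) (v : V) (w : W), l[p] = u ⊗ₜ[K] v ⊗ₜ[K] w := fun p => by
    obtain ⟨u, v, w, -, -, -, e⟩ := hpure l[p] (by simp)
    exact ⟨u, v, w, e⟩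
  choose u v w e using h
  refine ⟨u, v, w, ?_⟩
  change ∑ p : Fin l.length, u p ⊗ₜ[K] v p ⊗ₜ[K] w p = T
  simp_rw [← e, ← hsum]
  simp

/-- The contraction `u ⊗ v ⊗ w ↦ φ u * ψ v • w` of a tensor with two linear forms. -/
noncomputable def dualContraction (φ : Module.Dual K U) (ψ : Module.Dual K V) :
    U ⊗[K] V ⊗[K] W →ₗ[K] W :=
  TensorProduct.lid K W ∘ₗ (LinearMap.mul' K K ∘ₗ TensorProduct.map φ ψ).rTensor W

@[simp]
theorem dualContraction_tmul (φ : Module.Dual K U) (ψ : Module.Dual K V) (u : U) (v : V) (w : W) :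
    dualContraction φ ψ (u ⊗ₜ[K] v ⊗ₜ[K] w) = (φ u * ψ v) • w := by
  simp [dualContraction]

theorem toDualEquiv_symm_apply_eq_sum {ι : Type*} [Fintype ι] [DecidableEq ι]
    (b : Module.Basis ι K U) (φ : Module.Dual K U) :
    b.toDualEquiv.symm φ = ∑ i, φ (b i) • b i := by
  rw [← b.sum_repr (b.toDualEquiv.symm φ)]
  refine Finset.sum_congr rfl fun i _ => ?_
  rw [← b.toDual_apply_left, ← b.toDualEquiv_apply, LinearEquiv.apply_symm_apply]

theorem sum_toDualEquiv_symm_tmul {ι κ ρ : Type*} [Fintype ι] [DecidableEq ι] [Fintype κ]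
    [DecidableEq κ] [Fintype ρ] (b : Module.Basis ι K U) (c : Module.Basis κ K V)
    (φ : ρ → Module.Dual K U) (ψ : ρ → Module.Dual K V) (w : ρ → W) :
    ∑ p, b.toDualEquiv.symm (φ p) ⊗ₜ[K] c.toDualEquiv.symm (ψ p) ⊗ₜ[K] w p =
      ∑ ij : ι × κ, b ij.1 ⊗ₜ[K] c ij.2 ⊗ₜ[K] ∑ p, (φ p (b ij.1) * ψ p (c ij.2)) • w p := by
  calc _ = ∑ p, ∑ ij : ι × κ, (φ p (b ij.1) * ψ p (c ij.2)) • (b ij.1 ⊗ₜ[K] c ij.2 ⊗ₜ[K] w p) := by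
        refine Finset.sum_congr rfl fun p _ => ?_
        simp only [toDualEquiv_symm_apply_eq_sum, TensorProduct.sum_tmul, TensorProduct.tmul_sum,
          TensorProduct.tmul_smul, ← TensorProduct.smul_tmul', Finset.smul_sum, smul_smul, mul_comm,
          Fintype.sum_prod_type_right]
    _ = _ := by
        rw [Finset.sum_comm]
        simp only [TensorProduct.tmul_sum, TensorProduct.tmul_smul]

end TensorRep

variable {K : Type*} [Field K] {n m : ℕ}

theorem coe_dualContraction_polyMulTensor (f : degreeLE K (n : WithBot ℕ))
    (g : degreeLE K (m : WithBot ℕ)) :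
    ((dualContraction ((monomialBasis K n).toDual f) ((monomialBasis K m).toDual g)
      (polyMulTensor K n m) : degreeLE K ((n + m : ℕ) : WithBot ℕ)) : K[X]) = f * g := by
  have hsum : ∀ {d : ℕ} (e : degreeLE K (d : WithBot ℕ)), (e : K[X]) =
      ∑ i : Fin (d + 1), (monomialBasis K d).toDual e (monomialLE K d i) • X ^ (i : ℕ) :=
    fun {d} e => by
      conv_lhs => rw [← (monomialBasis K d).sum_repr e]
      simp only [← Module.Basis.toDual_apply_left, monomialBasis_apply, Submodule.coe_sum,
        Submodule.coe_smul]
      rfl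
  conv_rhs => rw [hsum f, hsum g, Finset.sum_mul_sum, ← Fintype.sum_prod_type']
  simp only [polyMulTensor, stdTerm, map_sum, dualContraction_tmul, Submodule.coe_sum,
    Submodule.coe_smul, smul_mul_smul_comm, ← pow_add]
  rfl

theorem TensorRep.exists_isMulAlgorithm (S : TensorRep (polyMulTensor K n m)) :
    ∃ (α : Fin S.length → Module.Dual K (degreeLE K (n : WithBot ℕ)))
      (β : Fin S.length → Module.Dual K (degreeLE K (m : WithBot ℕ))) (w : Fin S.length → K[X]),
      IsMulAlgorithm α β w := by
  obtain ⟨u, v, w, hT⟩ := S.exists_factors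
  refine ⟨fun p => (monomialBasis K n).toDualFlip (u p),
    fun p => (monomialBasis K m).toDualFlip (v p), fun p => w p, fun f g => ?_⟩
  calc _ = ((dualContraction ((monomialBasis K n).toDual f) ((monomialBasis K m).toDual g)
        (∑ p, u p ⊗ₜ[K] v p ⊗ₜ[K] w p) : degreeLE K ((n + m : ℕ) : WithBot ℕ)) : K[X]) := by
        simp [Module.Basis.toDualFlip_apply]
    _ = f * g := by rw [hT, coe_dualContraction_polyMulTensor]

theorem IsMulAlgorithm.sum_tmul_eq {ι : Type*} [Fintype ι]
    {α : ι → Module.Dual K (degreeLE K (n : WithBot ℕ))}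
    {β : ι → Module.Dual K (degreeLE K (m : WithBot ℕ))}
    {w : ι → degreeLE K ((n + m : ℕ) : WithBot ℕ)} (h : IsMulAlgorithm α β fun p => (w p : K[X])) :
    ∑ p, (monomialBasis K n).toDualEquiv.symm (α p) ⊗ₜ[K]
      (monomialBasis K m).toDualEquiv.symm (β p) ⊗ₜ[K] w p = polyMulTensor K n m := by
  rw [sum_toDualEquiv_symm_tmul, polyMulTensor]
  refine Finset.sum_congr rfl fun ij _ => ?_
  rw [stdTerm, monomialBasis_apply, monomialBasis_apply]
  refine congrArg _ (Subtype.ext ?_)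
  rw [Submodule.coe_sum]
  exact (h _ _).trans (pow_add X _ _).symm

theorem IsMulAlgorithm.exists_tensorRep {ι : Type*} [Fintype ι]
    {α : ι → Module.Dual K (degreeLE K (n : WithBot ℕ))}
    {β : ι → Module.Dual K (degreeLE K (m : WithBot ℕ))}
    {w : ι → degreeLE K ((n + m : ℕ) : WithBot ℕ)} (h : IsMulAlgorithm α β fun p => (w p : K[X]))
    (hα : ∀ p, α p ≠ 0) (hβ : ∀ p, β p ≠ 0) (hw : ∀ p, w p ≠ 0) :
    ∃ S : TensorRep (polyMulTensor K n m), S.length = Fintype.card ι := by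
  refine ⟨⟨Finset.univ.val.map fun p => (monomialBasis K n).toDualEquiv.symm (α p) ⊗ₜ[K]
    (monomialBasis K m).toDualEquiv.symm (β p) ⊗ₜ[K] w p, fun t ht => ?_, h.sum_tmul_eq⟩, ?_⟩
  · obtain ⟨p, -, rfl⟩ := Multiset.mem_map.1 ht
    exact ⟨_, _, _, by simpa using hα p, by simpa using hβ p, hw p, rfl⟩
  · simp [TensorRep.length]

/-- Evaluation at `x` on the space of polynomials of degree at most `n`. -/
noncomputable def evalLE (n : ℕ) (x : K) : Module.Dual K (degreeLE K (n : WithBot ℕ)) :=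
  leval x ∘ₗ Submodule.subtype _

theorem evalLE_ne_zero (n : ℕ) (x : K) : evalLE n x ≠ 0 := fun h => by
  simpa [evalLE, monomialLE] using LinearMap.congr_fun h (monomialLE K n 0)

theorem degree_lagrange_basis_le {r : ℕ} {a : Fin (r + 1) → K} (ha : Function.Injective a)
    (p : Fin (r + 1)) : (Lagrange.basis Finset.univ a p).degree ≤ r := by
  simp [Lagrange.degree_basis ha.injOn (Finset.mem_univ p)]

theorem isMulAlgorithm_evalLE {a : Fin (n + m + 1) → K} (ha : Function.Injective a) :
    IsMulAlgorithm (fun p => evalLE n (a p)) (fun p => evalLE m (a p))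
      fun p => Lagrange.basis Finset.univ a p := fun f g => by
  have hdeg : (f * g : K[X]).degree < (Finset.univ : Finset (Fin (n + m + 1))).card := by
    rw [Finset.card_univ, Fintype.card_fin]
    refine (degree_mul_le _ _).trans_lt ?_
    refine (add_le_add (mem_degreeLE.1 f.2) (mem_degreeLE.1 g.2)).trans_lt ?_
    exact_mod_cast Nat.lt_succ_self _
  rw [Lagrange.eq_interpolate ha.injOn hdeg, Lagrange.interpolate_apply]
  simp [evalLE, smul_eq_C_mul]

theorem tensorRank_polyMulTensor_of_lt_card (h : ((n + m : ℕ) : ℕ∞) < ENat.card K) :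
    tensorRank (polyMulTensor K n m) = n + m + 1 := by
  obtain ⟨a⟩ : Nonempty (Fin (n + m + 1) ↪ K) := by
    have hle : ((n + m + 1 : ℕ) : Cardinal) ≤ Cardinal.mk K := by
      rw [← Cardinal.natCast_le_toENat]
      exact_mod_cast Order.add_one_le_of_lt h
    exact Cardinal.lift_mk_le'.1 (by simpa using hle)
  let w (p : Fin (n + m + 1)) : degreeLE K ((n + m : ℕ) : WithBot ℕ) :=
    ⟨Lagrange.basis Finset.univ a p, mem_degreeLE.2 (degree_lagrange_basis_le a.injective p)⟩
  obtain ⟨S, hS⟩ := IsMulAlgorithm.exists_tensorRep (w := w) (isMulAlgorithm_evalLE a.injective)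
    (fun _ => evalLE_ne_zero _ _) (fun _ => evalLE_ne_zero _ _) fun p hp =>
      Lagrange.basis_ne_zero a.injective.injOn (Finset.mem_univ p) (congrArg Subtype.val hp)
  refine tensorRank_eq S (hS.trans (Fintype.card_fin _)) fun S => ?_
  obtain ⟨α, β, w, halg⟩ := S.exists_isMulAlgorithm
  simpa using halg.add_lt_card

end Rank

section FlipPaths

open Finset

section Reachability

variable {K U V W : Type*} [Field K] [AddCommGroup U] [AddCommGroup V] [AddCommGroup W]
  [Module K U] [Module K V] [Module K W]

theorem FlipPair.add_eq {s t s' t' : U ⊗[K] V ⊗[K] W} (h : FlipPair s t s' t') :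
    s' + t' = s + t := by
  cases h <;>
  simp only [TensorProduct.tmul_add, TensorProduct.add_tmul, TensorProduct.tmul_sub,
    TensorProduct.sub_tmul, TensorProduct.tmul_smul, ← TensorProduct.smul_tmul'] <;> abel

theorem ReductionPair.add_eq {s t r : U ⊗[K] V ⊗[K] W} (h : ReductionPair s t r) : r = s + t := by
  cases h <;> simp only [TensorProduct.tmul_add, TensorProduct.add_tmul]

/-- The terms `N` can be reached from the terms `M` by flips and reductions inside every
representation which contains `M`, whatever the tensor and the remaining terms `R` are. -/
def FlipReachable (M N : Multiset (U ⊗[K] V ⊗[K] W)) : Prop :=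
  ∀ (T : U ⊗[K] V ⊗[K] W) (S : TensorRep T) (R : Multiset (U ⊗[K] V ⊗[K] W)),
    S.terms = M + R → ∃ S' : TensorRep T, HasFlipPath S S' ∧ S'.terms = N + R

namespace FlipReachable

variable {M N L M' N' : Multiset (U ⊗[K] V ⊗[K] W)}

theorem refl (M : Multiset (U ⊗[K] V ⊗[K] W)) : FlipReachable M M :=
  fun _ S _ hS => ⟨S, .refl, hS⟩

theorem trans (h : FlipReachable M N) (h' : FlipReachable N L) : FlipReachable M L :=
  fun T S R hS => by
    obtain ⟨S₁, hpath, hS₁⟩ := h T S R hS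
    obtain ⟨S₂, hpath', hS₂⟩ := h' T S₁ R hS₁
    exact ⟨S₂, hpath.trans hpath', hS₂⟩

theorem add (h : FlipReachable M N) (h' : FlipReachable M' N') :
    FlipReachable (M + M') (N + N') := fun T S R hS => by
  obtain ⟨S₁, hpath, hS₁⟩ := h T S (M' + R) (by rw [hS, add_assoc])
  obtain ⟨S₂, hpath', hS₂⟩ := h' T S₁ (N + R) (by rw [hS₁, add_left_comm])
  exact ⟨S₂, hpath.trans hpath', by rw [hS₂, add_left_comm, add_assoc]⟩

theorem sum {ι : Type*} {s : Finset ι} {f g : ι → Multiset (U ⊗[K] V ⊗[K] W)}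
    (h : ∀ i ∈ s, FlipReachable (f i) (g i)) :
    FlipReachable (∑ i ∈ s, f i) (∑ i ∈ s, g i) := by
  induction s using Finset.cons_induction with
  | empty => exact refl _
  | cons i s hi ih =>
    rw [sum_cons, sum_cons]
    exact (h i (mem_cons_self i s)).add (ih fun j hj => h j (mem_cons_of_mem hj))

end FlipReachable

theorem FlipPair.flipReachable {s t s' t' : U ⊗[K] V ⊗[K] W} (h : FlipPair s t s' t')
    (hs' : IsPureTensor s') (ht' : IsPureTensor t') : FlipReachable {s, t} {s', t'} :=
  fun T S R hS => by
    have hterms : S.terms = s ::ₘ t ::ₘ R := by simpa using hS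
    refine ⟨⟨s' ::ₘ t' ::ₘ R, ?_, ?_⟩, .single (.inl ⟨R, s, t, s', t', h, hterms, rfl⟩), by simp⟩
    · have hpure := S.pure
      simp_all
    · rw [← S.sum_eq, hterms]
      simp only [Multiset.sum_cons, ← add_assoc, h.add_eq]

theorem ReductionPair.flipReachable {s t r : U ⊗[K] V ⊗[K] W} (h : ReductionPair s t r)
    (hr : IsPureTensor r) : FlipReachable {s, t} {r} := fun T S R hS => by
  have hterms : S.terms = s ::ₘ t ::ₘ R := by simpa using hS
  refine ⟨⟨r ::ₘ R, ?_, ?_⟩, .single (.inr ⟨R, s, t, r, h, hterms, rfl⟩), by simp⟩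
  · have hpure := S.pure
    simp_all
  · rw [← S.sum_eq, hterms]
    simp only [Multiset.sum_cons, ← add_assoc, h.add_eq]

theorem isPureTensor_tmul {u : U} {v : V} {w : W} (hu : u ≠ 0) (hv : v ≠ 0) (hw : w ≠ 0) :
    IsPureTensor (u ⊗ₜ[K] v ⊗ₜ[K] w) :=
  ⟨u, v, w, hu, hv, hw, rfl⟩

theorem sum_ne_zero_of_linearIndependent {I : Type*} {a : I → U} (ha : LinearIndependent K a)
    {s : Finset I} (hs : s.Nonempty) : ∑ i ∈ s, a i ≠ 0 := fun h => by
  obtain ⟨i, hi⟩ := hs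
  exact one_ne_zero (linearIndependent_iff'.1 ha s (fun _ => 1) (by simpa using h) i hi)

theorem flipReachable_sum_first {I : Type*} {a : I → U} (ha : LinearIndependent K a)
    {s : Finset I} (hs : s.Nonempty) {v : V} (hv : v ≠ 0) {w : W} (hw : w ≠ 0) :
    FlipReachable (∑ i ∈ s, {a i ⊗ₜ[K] v ⊗ₜ[K] w}) {(∑ i ∈ s, a i) ⊗ₜ[K] v ⊗ₜ[K] w} := by
  induction hs using Finset.Nonempty.cons_induction with
  | singleton i => simpa using FlipReachable.refl _
  | cons i s hi _ ih =>
    have hsum := sum_ne_zero_of_linearIndependent ha (cons_nonempty hi)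
    rw [sum_cons] at hsum ⊢
    rw [sum_cons]
    exact ((FlipReachable.refl _).add ih).trans
      ((ReductionPair.first _ _ v w).flipReachable (isPureTensor_tmul hsum hv hw))

theorem linearIndependent_sum_smul_of_det_ne_zero {J : Type*} [Fintype J] [DecidableEq J]
    {w : J → W} (hw : LinearIndependent K w) {G : Matrix J J K} (hG : G.det ≠ 0) :
    LinearIndependent K fun i => ∑ j, G i j • w j :=
  (Matrix.linearIndependent_rows_of_det_ne_zero hG).map' (Fintype.linearCombination K w)
    (LinearMap.ker_eq_bot.2 (linearIndependent_iff_injective_fintypeLinearCombination.1 hw))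

theorem exists_dual_apply_eq_ite {J : Type*} [DecidableEq J] {v : J → V}
    (hv : LinearIndependent K v) :
    ∃ φ : J → Module.Dual K V, ∀ i j, φ i (v j) = if i = j then 1 else 0 := by
  obtain ⟨g, hg⟩ := (Finsupp.linearCombination K v).exists_leftInverse_of_injective
    (LinearMap.ker_eq_bot.2 hv.finsuppLinearCombination_injective)
  refine ⟨fun i => Finsupp.lapply i ∘ₗ g, fun i j => ?_⟩
  simpa [Finsupp.single_apply, eq_comm] using
    DFunLike.congr_fun (LinearMap.congr_fun hg (Finsupp.single j 1)) i

section LinearlyIndependentTerms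

variable {J : Type*} [Fintype J] [DecidableEq J] {v v' : J → V} {w w' : J → W}

theorem exists_matrix_of_sum_tmul_eq (hv : LinearIndependent K v) (hw : LinearIndependent K w)
    (h : ∑ i, v i ⊗ₜ[K] w i = ∑ i, v' i ⊗ₜ[K] w' i) :
    ∃ G : Matrix J J K, G.det ≠ 0 ∧ LinearIndependent K v' ∧
      v = (fun j => ∑ i, G i j • v' i) ∧ w' = fun i => ∑ j, G i j • w j := by
  obtain ⟨φ, hφ⟩ := exists_dual_apply_eq_ite hw
  have hvG : v = fun j => ∑ i, φ j (w' i) • v' i := funext fun j => by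
    simpa [hφ] using
      congrArg (fun x => TensorProduct.rid K V ((φ j).lTensor V x)) h
  have hv' : LinearIndependent K v' := by
    have := Module.Finite.span_of_finite K (Set.finite_range v')
    rw [linearIndependent_iff_card_le_finrank_span, ← finrank_span_eq_card hv]
    refine Submodule.finrank_mono (Submodule.span_le.2 ?_)
    rintro _ ⟨j, rfl⟩
    rw [hvG]
    exact Submodule.sum_mem _ fun i _ =>
      Submodule.smul_mem _ _ (Submodule.subset_span (Set.mem_range_self i))
  refine ⟨Matrix.of fun i j => φ j (w' i), fun hdet => ?_, hv', hvG, funext fun i => ?_⟩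
  · obtain ⟨c, hc, hGc⟩ := Matrix.exists_mulVec_eq_zero_iff.2 hdet
    refine hc (funext (Fintype.linearIndependent_iff.1 hv c ?_))
    calc ∑ j, c j • v j = ∑ i, (∑ j, φ j (w' i) * c j) • v' i := by
          rw [hvG]
          simp only [smul_sum, smul_smul, sum_smul, mul_comm]
          exact sum_comm
      _ = 0 := sum_eq_zero fun i _ => by
          rw [show ∑ j, φ j (w' i) * c j = 0 from congrFun hGc i, zero_smul]
  · obtain ⟨ψ, hψ⟩ := exists_dual_apply_eq_ite hv'
    have := congrArg (fun x => TensorProduct.lid K W ((ψ i).rTensor W x)) h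
    rw [hvG] at this
    simpa [hψ] using this.symm

theorem flipReachable_sum_transvection {u : U} (hu : u ≠ 0) (hv : ∀ i, v i ≠ 0)
    (hw : LinearIndependent K w) (t : Matrix.TransvectionStruct J K) :
    FlipReachable (∑ j, {u ⊗ₜ[K] (∑ i, t.toMatrix i j • v i) ⊗ₜ[K] w j})
      (∑ i, {u ⊗ₜ[K] v i ⊗ₜ[K] ∑ j, t.toMatrix i j • w j}) := by
  obtain ⟨i, j, hij, c⟩ := t
  have hcol : ∀ l, ∑ k, Matrix.transvection i j c k l • v k =
      v l + if j = l then c • v i else 0 := fun l => by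
    simp [Matrix.transvection, Matrix.one_apply, Matrix.single_apply, add_smul, sum_add_distrib,
      ite_and]
  have hrow : ∀ k, ∑ l, Matrix.transvection i j c k l • w l =
      w k + if i = k then c • w j else 0 := fun k => by
    simp [Matrix.transvection, Matrix.one_apply, Matrix.single_apply, add_smul, sum_add_distrib,
      ite_and]
  have hrow_ne := (linearIndependent_sum_smul_of_det_ne_zero hw
    (G := Matrix.transvection i j c) (by simp [hij])).ne_zero i
  simp only [Matrix.TransvectionStruct.toMatrix, hcol, hrow] at hrow_ne ⊢
  rw [← sum_add_sum_compl {j, i}, ← sum_add_sum_compl {j, i}, sum_pair hij.symm, sum_pair hij.symm]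
  refine FlipReachable.add ?_ (FlipReachable.sum fun k hk => ?_)
  · have h := (FlipPair.first c u (v j + c • v i) (v i) (w j) (w i)).flipReachable
      (isPureTensor_tmul hu (by simpa using hv j) (hw.ne_zero j))
      (isPureTensor_tmul hu (hv i) (by simpa using hrow_ne))
    simpa [hij, hij.symm] using h
  · simp only [mem_compl, mem_insert, mem_singleton, not_or] at hk
    simpa [Ne.symm hk.1, Ne.symm hk.2] using FlipReachable.refl _

theorem flipReachable_sum_matrix {u : U} (hu : u ≠ 0) {G : Matrix J J K} (hG : G.det ≠ 0)
    (hv : LinearIndependent K v) (hw : LinearIndependent K w) :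
    FlipReachable (∑ j, {u ⊗ₜ[K] (∑ i, G i j • v i) ⊗ₜ[K] w j})
      (∑ i, {u ⊗ₜ[K] v i ⊗ₜ[K] ∑ j, G i j • w j}) := by
  refine Matrix.diagonal_transvection_induction_of_det_ne_zero (fun G => ∀ {v : J → V} {w : J → W},
    LinearIndependent K v → LinearIndependent K w →
      FlipReachable (∑ j, {u ⊗ₜ[K] (∑ i, G i j • v i) ⊗ₜ[K] w j})
        (∑ i, {u ⊗ₜ[K] v i ⊗ₜ[K] ∑ j, G i j • w j})) G hG ?_ ?_ ?_ hv hw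
  · intro D _ v w _ _
    simpa [Matrix.diagonal_apply, TensorProduct.tmul_smul, TensorProduct.smul_tmul'] using
      FlipReachable.refl _
  · exact fun t v w hv hw => flipReachable_sum_transvection hu hv.ne_zero hw t
  · intro A B hA hB ihA ihB v w hv hw
    have hAv := linearIndependent_sum_smul_of_det_ne_zero hv (G := A.transpose) (by simpa using hA)
    have hBw := linearIndependent_sum_smul_of_det_ne_zero hw hB
    have hv_mul : ∀ j, ∑ i, (A * B) i j • v i = ∑ k, B k j • ∑ i, A i k • v i := fun j => by
      simp only [Matrix.mul_apply, sum_smul, smul_sum, smul_smul, mul_comm]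
      exact sum_comm
    have hw_mul : ∀ i, ∑ j, (A * B) i j • w j = ∑ k, A i k • ∑ j, B k j • w j := fun i => by
      simp only [Matrix.mul_apply, sum_smul, smul_sum, smul_smul]
      exact sum_comm
    simpa only [hv_mul, hw_mul, Matrix.transpose_apply] using (ihB hAv hw).trans (ihA hv hBw)

end LinearlyIndependentTerms

theorem flipReachable_of_sum_tmul_eq {J P : Type*} [Fintype J] {u : U} (hu : u ≠ 0) {v : J → V}
    {w : J → W} (hv : LinearIndependent K v) (hw : LinearIndependent K w) {s : Finset P}
    (hs : #s = Fintype.card J) {v' : P → V} {w' : P → W}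
    (h : ∑ j, v j ⊗ₜ[K] w j = ∑ p ∈ s, v' p ⊗ₜ[K] w' p) :
    FlipReachable (∑ j, {u ⊗ₜ[K] v j ⊗ₜ[K] w j}) (∑ p ∈ s, {u ⊗ₜ[K] v' p ⊗ₜ[K] w' p}) := by
  classical
  have e : J ≃ s := Fintype.equivOfCardEq (by simp [hs])
  rw [← sum_coe_sort s, ← e.sum_comp] at h ⊢
  obtain ⟨G, hG, hv', rfl, hwG⟩ := exists_matrix_of_sum_tmul_eq hv hw h
  simp only [congrFun hwG]
  exact flipReachable_sum_matrix hu hG hv' hw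

theorem flipReachable_of_forall_sum_tmul_eq {I J P : Type*} [Fintype I] [DecidableEq I] [Fintype J]
    [Fintype P] {a : I → U} (ha : LinearIndependent K a) {x : I → J → V} {y : I → J → W}
    (hx : ∀ i, LinearIndependent K (x i)) (hy : ∀ i, LinearIndependent K (y i))
    {s : P → Finset I} (hs : ∀ p, (s p).Nonempty) (hcard : ∀ i, #{p | i ∈ s p} = Fintype.card J)
    {v : P → V} (hv : ∀ p, v p ≠ 0) {w : P → W} (hw : ∀ p, w p ≠ 0)
    (h : ∀ i, ∑ j, x i j ⊗ₜ[K] y i j = ∑ p with i ∈ s p, v p ⊗ₜ[K] w p) :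
    FlipReachable (∑ i, ∑ j, {a i ⊗ₜ[K] x i j ⊗ₜ[K] y i j})
      (∑ p, {(∑ i ∈ s p, a i) ⊗ₜ[K] v p ⊗ₜ[K] w p}) := by
  have hrows : FlipReachable (∑ i, ∑ j, {a i ⊗ₜ[K] x i j ⊗ₜ[K] y i j})
      (∑ i, ∑ p with i ∈ s p, {a i ⊗ₜ[K] v p ⊗ₜ[K] w p}) :=
    .sum fun i _ => flipReachable_of_sum_tmul_eq (ha.ne_zero i) (hx i) (hy i) (hcard i) (h i)
  rw [sum_comm' (s' := s) (t' := univ) (by simp)] at hrows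
  exact hrows.trans (.sum fun p _ => flipReachable_sum_first ha (hs p) (hv p) (hw p))

theorem sum_tmul_sum_eq_sum_card_smul {J L P : Type*} [Fintype J] [DecidableEq J] [Fintype L]
    [DecidableEq L] (x : J → V) (z : L → W) (s : Finset P) (B : P → Finset J)
    (C : P → Finset L) : ∑ p ∈ s, (∑ j ∈ B p, x j) ⊗ₜ[K] (∑ l ∈ C p, z l) =
      ∑ j, ∑ l, (#{p ∈ s | j ∈ B p ∧ l ∈ C p} : K) • (x j ⊗ₜ[K] z l) := by
  calc _ = ∑ p ∈ s, ∑ j, ∑ l, (if j ∈ B p ∧ l ∈ C p then 1 else 0 : K) • (x j ⊗ₜ[K] z l) := by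
        refine sum_congr rfl fun p _ => ?_
        rw [TensorProduct.sum_tmul]
        simp [TensorProduct.tmul_sum, ite_and, sum_ite_mem]
    _ = _ := by
        rw [sum_comm]
        refine sum_congr rfl fun j _ => ?_
        rw [sum_comm]
        simp only [natCast_card_filter, sum_smul]

end Reachability

theorem linearIndependent_monomialLE (K : Type*) [Field K] (n : ℕ) :
    LinearIndependent K (monomialLE K n) := by
  have h : ⇑(monomialBasis K n) = monomialLE K n := funext monomialBasis_apply
  exact h ▸ (monomialBasis K n).linearIndependent

/-- The terms `(∑ i ∈ a, x ^ i) ⊗ (∑ j ∈ b, x ^ j) ⊗ (∑ k ∈ c, x ^ k)` over the field with two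
elements, for `(a, b, c) = t p`, are nonzero and sum to the multiplication tensor (the parity
condition compares coefficients). Moreover each `x ^ i` occurs in `m + 1` first factors, as in the
standard representation, so that flips can turn its standard terms into those of the scheme with
its first factors expanded. -/
abbrev IsFlipScheme {n m r : ℕ}
    (t : Fin r → Finset (Fin (n + 1)) × Finset (Fin (m + 1)) × Finset (Fin (n + m + 1))) : Prop :=
  (∀ p, (t p).1.Nonempty ∧ (t p).2.1.Nonempty ∧ (t p).2.2.Nonempty) ∧
    (∀ i, #{p | i ∈ (t p).1} = m + 1) ∧
    ∀ i j k, Odd #{p | i ∈ (t p).1 ∧ j ∈ (t p).2.1 ∧ k ∈ (t p).2.2} ↔ (i + j : ℕ) = k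

theorem IsFlipScheme.exists_hasFlipPath {n m r : ℕ}
    {t : Fin r → Finset (Fin (n + 1)) × Finset (Fin (m + 1)) × Finset (Fin (n + m + 1))}
    (h : IsFlipScheme t) :
    ∃ S, HasFlipPath (standardRep (ZMod 2) n m) S ∧ S.length = r := by
  obtain ⟨hne, hcard, hodd⟩ := h
  have hbasis := linearIndependent_monomialLE (ZMod 2)
  have hreach := flipReachable_of_forall_sum_tmul_eq (hbasis n)
    (x := fun _ j => monomialLE (ZMod 2) m j)
    (y := fun i j => monomialLE (ZMod 2) (n + m) ⟨i + j, by omega⟩)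
    (fun _ => hbasis m)
    (fun i => (hbasis (n + m)).comp (fun j : Fin (m + 1) => ⟨i + j, by omega⟩)
      fun j j' hj => by simpa [Fin.ext_iff] using hj)
    (fun p => (hne p).1) (by simpa using hcard)
    (fun p => sum_ne_zero_of_linearIndependent (hbasis m) (hne p).2.1)
    (fun p => sum_ne_zero_of_linearIndependent (hbasis (n + m)) (hne p).2.2) fun i => by
      rw [sum_tmul_sum_eq_sum_card_smul]
      refine sum_congr rfl fun j _ => ?_
      have hcoeff : ∀ k, (#{p | i ∈ (t p).1 ∧ j ∈ (t p).2.1 ∧ k ∈ (t p).2.2} : ZMod 2) =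
          if (⟨i + j, by omega⟩ : Fin (n + m + 1)) = k then 1 else 0 := fun k => by
        split_ifs with hk
        · exact ZMod.natCast_eq_one_iff_odd.2 ((hodd i j k).2 (congrArg Fin.val hk))
        · exact ZMod.natCast_eq_zero_iff_even.2 (Nat.not_odd_iff_even.1 fun h =>
            hk (Fin.ext ((hodd i j k).1 h)))
      simp [filter_filter, hcoeff]
  obtain ⟨S, hpath, hS⟩ := hreach _ (standardRep (ZMod 2) n m) 0 (by
    rw [← Fintype.sum_prod_type', add_zero, ← Multiset.sum_map_singleton (standardRep _ n m).terms,
      standardRep, Multiset.map_map]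
    rfl)
  exact ⟨S, hpath, by simp [TensorRep.length, hS]⟩

end FlipPaths

theorem TensorRep.sum_ceilDiv_le_length {K : Type*} [Field K] [Fintype K] {n m : ℕ}
    (S : TensorRep (polyMulTensor K n m)) :
    ∑ i ∈ Finset.range (n + 1), (m + 1) ⌈/⌉ Fintype.card K ^ i ≤ S.length := by
  obtain ⟨α, β, w, h⟩ := S.exists_isMulAlgorithm
  simpa using h.sum_ceilDiv_le_card

theorem TensorRep.add_six_le_length {n : ℕ} (hn : 2 ≤ n)
    (S : TensorRep (polyMulTensor (ZMod 2) n 3)) : n + 6 ≤ S.length := by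
  obtain ⟨α, β, w, h⟩ := S.exists_isMulAlgorithm
  simpa using h.swap.add_six_le_card_of_cubic hn

section Optimality

variable {n m r : ℕ}
  {t : Fin r → Finset (Fin (n + 1)) × Finset (Fin (m + 1)) × Finset (Fin (n + m + 1))}

theorem IsFlipScheme.tensorRank_eq_and_hasFlipPath (h : IsFlipScheme t)
    (hlower : ∀ S : TensorRep (polyMulTensor (ZMod 2) n m), r ≤ S.length) :
    tensorRank (polyMulTensor (ZMod 2) n m) = r ∧
      ∃ S : TensorRep (polyMulTensor (ZMod 2) n m), HasFlipPath (standardRep (ZMod 2) n m) S ∧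
        S.length = tensorRank (polyMulTensor (ZMod 2) n m) := by
  obtain ⟨S, hpath, hS⟩ := h.exists_hasFlipPath
  have hrank := tensorRank_eq S hS hlower
  exact ⟨hrank, S, hpath, hS.trans hrank.symm⟩

theorem IsFlipScheme.tensorRank_eq_and_hasFlipPath_of_le_sum_ceilDiv (h : IsFlipScheme t)
    (hr : r ≤ ∑ i ∈ Finset.range (n + 1), (m + 1) ⌈/⌉ 2 ^ i) :
    tensorRank (polyMulTensor (ZMod 2) n m) = r ∧
      ∃ S : TensorRep (polyMulTensor (ZMod 2) n m), HasFlipPath (standardRep (ZMod 2) n m) S ∧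
        S.length = tensorRank (polyMulTensor (ZMod 2) n m) :=
  h.tensorRank_eq_and_hasFlipPath fun S => hr.trans <| by
    simpa only [ZMod.card] using S.sum_ceilDiv_le_length

end Optimality

-- Apart from `(2, 3)` and `(2, 4)`, these apply the Karatsuba scheme for `(1, 1)` to blocks or
-- pairs of coefficients, twice in the case of `(3, 3)`.
theorem isFlipScheme_one_one : IsFlipScheme (n := 1) (m := 1)
    ![({0}, {0}, {0, 1}), ({1}, {1}, {1, 2}), ({0, 1}, {0, 1}, {1})] := by
  decide +kernel

theorem isFlipScheme_one_two : IsFlipScheme (n := 1) (m := 2)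
    ![({0}, {2}, {2}), ({1}, {2}, {3}), ({0}, {0}, {0, 1}), ({1}, {1}, {1, 2}),
      ({0, 1}, {0, 1}, {1})] := by
  decide +kernel

theorem isFlipScheme_one_three : IsFlipScheme (n := 1) (m := 3)
    ![({0}, {0}, {0, 1}), ({1}, {1}, {1, 2}), ({0, 1}, {0, 1}, {1}), ({0}, {2}, {2, 3}),
      ({1}, {3}, {3, 4}), ({0, 1}, {2, 3}, {3})] := by
  decide +kernel

theorem isFlipScheme_one_four : IsFlipScheme (n := 1) (m := 4)
    ![({0}, {4}, {4}), ({1}, {4}, {5}), ({0}, {0}, {0, 1}), ({1}, {1}, {1, 2}),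
      ({0, 1}, {0, 1}, {1}), ({0}, {2}, {2, 3}), ({1}, {3}, {3, 4}), ({0, 1}, {2, 3}, {3})] := by
  decide +kernel

theorem isFlipScheme_one_five : IsFlipScheme (n := 1) (m := 5)
    ![({0}, {0}, {0, 1}), ({1}, {1}, {1, 2}), ({0, 1}, {0, 1}, {1}), ({0}, {2}, {2, 3}),
      ({1}, {3}, {3, 4}), ({0, 1}, {2, 3}, {3}), ({0}, {4}, {4, 5}), ({1}, {5}, {5, 6}),
      ({0, 1}, {4, 5}, {5})] := by
  decide +kernel

theorem isFlipScheme_two_two : IsFlipScheme (n := 2) (m := 2)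
    ![({0, 1}, {0, 1}, {1}), ({1}, {1}, {1, 2, 3}), ({1, 2}, {1, 2}, {3}), ({0}, {0}, {0, 1, 2}),
      ({2}, {2}, {2, 3, 4}), ({0, 2}, {0, 2}, {2})] := by
  decide +kernel

theorem isFlipScheme_two_three : IsFlipScheme (n := 2) (m := 3)
    ![({1}, {0}, {1, 2}), ({1}, {2}, {3, 4}), ({2}, {3}, {2, 3, 4, 5}), ({0, 2}, {1, 3}, {2, 3}),
      ({0}, {1}, {0, 1, 2, 3}), ({1, 2}, {2, 3}, {2, 4}), ({0}, {0, 1}, {0, 2}),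
      ({0, 1, 2}, {0, 1, 2, 3}, {2})] := by
  decide +kernel

theorem isFlipScheme_two_four : IsFlipScheme (n := 2) (m := 4)
    ![({0}, {0}, {0, 3}), ({1}, {0}, {1, 4}), ({0}, {1}, {1, 4}), ({2}, {3}, {2, 5}),
      ({1}, {4}, {2, 5}), ({2}, {4}, {3, 6}), ({1, 2}, {1, 2, 4}, {2, 4}),
      ({0, 1}, {0, 1, 3, 4}, {2, 3}), ({0, 2}, {0, 2, 3}, {3, 4}),
      ({0, 1, 2}, {0, 1, 2, 3, 4}, {2, 3, 4})] := by
  decide +kernel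

theorem isFlipScheme_three_three : IsFlipScheme (n := 3) (m := 3)
    ![({0}, {0}, {0, 1, 2, 3}), ({1}, {1}, {1, 2, 3, 4}), ({0, 1}, {0, 1}, {1, 3}),
      ({2}, {2}, {2, 3, 4, 5}), ({3}, {3}, {3, 4, 5, 6}), ({2, 3}, {2, 3}, {3, 5}),
      ({0, 2}, {0, 2}, {2, 3}), ({1, 3}, {1, 3}, {3, 4}), ({0, 1, 2, 3}, {0, 1, 2, 3}, {3})] := by
  decide +kernel

theorem mainTheorem3 :
    (∀ n m r : ℕ,
      (n, m, r) ∈ ([(1, 1, 3), (1, 2, 5), (1, 3, 6), (1, 4, 8), (1, 5, 9),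
        (2, 2, 6), (2, 3, 8), (2, 4, 10), (3, 3, 9)] : List (ℕ × ℕ × ℕ)) →
      tensorRank (polyMulTensor (ZMod 2) n m) = r ∧
        ∃ S : TensorRep (polyMulTensor (ZMod 2) n m),
          HasFlipPath (standardRep (ZMod 2) n m) S ∧
            S.length = tensorRank (polyMulTensor (ZMod 2) n m)) ∧
    (∀ (K : Type*) [Field K], 5 ≤ ENat.card K → tensorRank (polyMulTensor K 2 2) = 5) := by
  refine ⟨fun n m r h => ?_, fun K _ hK => ?_⟩
  · simp only [List.mem_cons, Prod.mk.injEq, List.not_mem_nil, or_false] at h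
    rcases h with ⟨rfl, rfl, rfl⟩ | ⟨rfl, rfl, rfl⟩ | ⟨rfl, rfl, rfl⟩ | ⟨rfl, rfl, rfl⟩ |
      ⟨rfl, rfl, rfl⟩ | ⟨rfl, rfl, rfl⟩ | ⟨rfl, rfl, rfl⟩ | ⟨rfl, rfl, rfl⟩ | ⟨rfl, rfl, rfl⟩
    · exact isFlipScheme_one_one.tensorRank_eq_and_hasFlipPath_of_le_sum_ceilDiv (by decide)
    · exact isFlipScheme_one_two.tensorRank_eq_and_hasFlipPath_of_le_sum_ceilDiv (by decide)
    · exact isFlipScheme_one_three.tensorRank_eq_and_hasFlipPath_of_le_sum_ceilDiv (by decide)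
    · exact isFlipScheme_one_four.tensorRank_eq_and_hasFlipPath_of_le_sum_ceilDiv (by decide)
    · exact isFlipScheme_one_five.tensorRank_eq_and_hasFlipPath_of_le_sum_ceilDiv (by decide)
    · exact isFlipScheme_two_two.tensorRank_eq_and_hasFlipPath_of_le_sum_ceilDiv (by decide)
    · exact isFlipScheme_two_three.tensorRank_eq_and_hasFlipPath fun S => S.add_six_le_length le_rfl
    · exact isFlipScheme_two_four.tensorRank_eq_and_hasFlipPath_of_le_sum_ceilDiv (by decide)
    · exact isFlipScheme_three_three.tensorRank_eq_and_hasFlipPath fun S =>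
        S.add_six_le_length (by decide)
  · exact tensorRank_polyMulTensor_of_lt_card (hK.trans_lt' (by norm_num))
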